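/- Let $D\subset\mathbb R^d$, $d\ge 1$, be a nonempty bounded open set (for instance a bounded Lipschitz domain), let $V=H^1_0(D)$ with norm $\|v\|_V=\|\nabla v\|_{L^2(D)}$, and let $f\in V^*$, with $\|f\|_{V^*}=\sup_{\|v\|_V\le 1}|f(v)|$. Let $a_0,\dots,a_M:D\to\mathbb R$ be measurable and put $a(x,y)=a_0(x)+\sum_{m=1}^M y_m a_m(x)$ for $y\in\mathbb C^M$. Let $\rho\in(1,\infty)^M$, let $B_{\mathbb C}(0,\rho)=\{y\in\mathbb C^M: |y_m|<\rho_m \text{ for all } m\}$, and assume the $\rho$-weighted uniform ellipticity condition $$c:=\inf_{x\in D}\Big(a_0(x)-\sum_{m=1}^M\rho_m|a_m(x)|\Big)>0,\qquad \|a\|_{L^\infty(D\times B_{\mathbb C}(0,\rho))}<\infty .$$ Let $(V_l)_{l\in\mathbb N}$ be finite-dimensional subspaces of $V$. Write $V_{\mathbb C}=H^1_0(D;\mathbb C)$, with norm $\|v\|_{V_{\mathbb C}}=\|\nabla v\|_{L^2(D)}$, and $V_{l,\mathbb C}=V_l+iV_l\subset V_{\mathbb C}$. Then: (i) For every $y\in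 B_{\mathbb C}(0,\rho)$ there is exactly one $u(y)\in V_{\mathbb C}$ with $$\int_D a(x,y)\,\nabla u(y)\cdot\nabla v\,dx=f(v)\qquad\text{for all } v\in V,$$ and for every $l$ exactly one $u_l(y)\in V_{l,\mathbb C}$ that satisfies this equation for all $v\in V_l$. (ii) For $y\in[-1,1]^M$, $u(y)$ is the real solution: the equation has exactly one solution in $V$, and it is $u(y)$. Likewise $u_l(y)$ is the Galerkin solution: there is exactly one element of $V_l$ that satisfies the equation for all $v\in V_l$, and it is $u_l(y)$. (iii) The maps $u,u_l:B_{\mathbb C}(0,\rho)\to V_{\mathbb C}$ are holomorphic, that is, they are holomorphic extensions of the parameter-to-solution maps on $[-1,1]^M$. (iv) For all $y\in B_{\mathbb C}(0,\rho)$ and all $l$, $$\|u(y)\|_{V_{\mathbb C}}\le \tfrac1c\|f\|_{V^*},\qquad \|u_l(y)\|_{V_{\mathbb C}}\le\tfrac1c\|f\|_{V^*}.$$ -/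

import Mathlib

open MeasureTheory Set
open scoped ContDiff

noncomputable section

/-- The ambient Hilbert space `L²(D; 𝕜) × L²(D; 𝕜)ᵈ` of pairs (function, gradient field), with norm
`(‖v‖² + ‖G‖²)^{1/2}`, that is, the `H¹` norm when `G = ∇v`. -/
abbrev L2Pair (𝕜 : Type) [RCLike 𝕜] {d : ℕ} (D : Set (EuclideanSpace ℝ (Fin d))) : Type :=
  WithLp 2 (Lp 𝕜 2 (volume.restrict D) × Lp (EuclideanSpace 𝕜 (Fin d)) 2 (volume.restrict D))

/-- The classical gradient `(∂₁φ, …, ∂_dφ)` of a `𝕜`-valued function on `ℝᵈ`. -/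
def classicalGrad {𝕜 : Type} [RCLike 𝕜] {d : ℕ} (φ : EuclideanSpace ℝ (Fin d) → 𝕜)
    (x : EuclideanSpace ℝ (Fin d)) : EuclideanSpace 𝕜 (Fin d) :=
  WithLp.toLp 2 fun i => fderiv ℝ φ x (EuclideanSpace.single i 1)

/-- `φ ∈ C_c^∞(D; 𝕜)`. -/
structure IsTestFunction {𝕜 : Type} [RCLike 𝕜] {d : ℕ} (D : Set (EuclideanSpace ℝ (Fin d)))
    (φ : EuclideanSpace ℝ (Fin d) → 𝕜) : Prop where
  contDiff : ContDiff ℝ ∞ φ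
  hasCompactSupport : HasCompactSupport φ
  tsupport_subset : tsupport φ ⊆ D

section TestFunctions

variable {𝕜 : Type} [RCLike 𝕜] {d : ℕ} {D : Set (EuclideanSpace ℝ (Fin d))}
  {φ ψ : EuclideanSpace ℝ (Fin d) → 𝕜}

theorem IsTestFunction.differentiable (hφ : IsTestFunction D φ) : Differentiable ℝ φ :=
  hφ.contDiff.differentiable (by simp)

theorem IsTestFunction.zero : IsTestFunction D (0 : EuclideanSpace ℝ (Fin d) → 𝕜) where
  contDiff := contDiff_const
  hasCompactSupport := HasCompactSupport.zero
  tsupport_subset := by simp [tsupport]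

theorem IsTestFunction.add (hφ : IsTestFunction D φ) (hψ : IsTestFunction D ψ) :
    IsTestFunction D (φ + ψ) where
  contDiff := hφ.contDiff.add hψ.contDiff
  hasCompactSupport := hφ.hasCompactSupport.add hψ.hasCompactSupport
  tsupport_subset := (tsupport_add φ ψ).trans (union_subset hφ.tsupport_subset hψ.tsupport_subset)

theorem IsTestFunction.const_smul (c : 𝕜) (hφ : IsTestFunction D φ) :
    IsTestFunction D (c • φ) where
  contDiff := contDiff_const.smul hφ.contDiff
  hasCompactSupport := hφ.hasCompactSupport.smul_left (f := fun _ => c)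
  tsupport_subset := (tsupport_smul_subset_right (fun _ => c) φ).trans hφ.tsupport_subset

theorem IsTestFunction.ofReal {φ : EuclideanSpace ℝ (Fin d) → ℝ} (hφ : IsTestFunction D φ) :
    IsTestFunction D (fun x => (φ x : ℂ)) where
  contDiff := Complex.ofRealCLM.contDiff.comp hφ.contDiff
  hasCompactSupport := hφ.hasCompactSupport.comp_left (g := Complex.ofReal) rfl
  tsupport_subset := (tsupport_comp_subset (g := Complex.ofReal) rfl φ).trans hφ.tsupport_subset

theorem classicalGrad_zero : classicalGrad (0 : EuclideanSpace ℝ (Fin d) → 𝕜) = 0 := by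
  funext x; ext i; simp [classicalGrad]

theorem classicalGrad_add (hφ : IsTestFunction D φ) (hψ : IsTestFunction D ψ) :
    classicalGrad (φ + ψ) = classicalGrad φ + classicalGrad ψ := by
  funext x; ext i
  simp [classicalGrad, fderiv_add (hφ.differentiable x) (hψ.differentiable x)]

theorem classicalGrad_const_smul (c : 𝕜) (hφ : IsTestFunction D φ) :
    classicalGrad (c • φ) = c • classicalGrad φ := by
  funext x; ext i
  simp [classicalGrad, fderiv_const_smul (hφ.differentiable x) c]

theorem classicalGrad_ofReal {φ : EuclideanSpace ℝ (Fin d) → ℝ} (hφ : IsTestFunction D φ)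
    (x : EuclideanSpace ℝ (Fin d)) (i : Fin d) :
    classicalGrad (fun x => (φ x : ℂ)) x i = (classicalGrad φ x i : ℂ) := by
  have h := (Complex.ofRealCLM.hasFDerivAt.comp x (hφ.differentiable x).hasFDerivAt).fderiv
  have h' : fderiv ℝ (fun x => (φ x : ℂ)) x = Complex.ofRealCLM.comp (fderiv ℝ φ x) := h
  simp [classicalGrad, h']

end TestFunctions

/-- The subspace `{(φ, ∇φ) : φ ∈ C_c^∞(D; 𝕜)}`. -/
def testPairs (𝕜 : Type) [RCLike 𝕜] {d : ℕ} (D : Set (EuclideanSpace ℝ (Fin d))) :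
    Submodule 𝕜 (L2Pair 𝕜 D) where
  carrier := {p | ∃ φ : EuclideanSpace ℝ (Fin d) → 𝕜, IsTestFunction D φ ∧
    p.fst =ᵐ[volume.restrict D] φ ∧ p.snd =ᵐ[volume.restrict D] classicalGrad φ}
  zero_mem' := ⟨0, IsTestFunction.zero, Lp.coeFn_zero _ _ _, by
    rw [classicalGrad_zero]; exact Lp.coeFn_zero _ _ _⟩
  add_mem' := by
    rintro p q ⟨φ, hφ, hp, hp'⟩ ⟨ψ, hψ, hq, hq'⟩
    refine ⟨φ + ψ, hφ.add hψ, (Lp.coeFn_add _ _).trans (hp.add hq), ?_⟩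
    rw [classicalGrad_add hφ hψ]
    exact (Lp.coeFn_add _ _).trans (hp'.add hq')
  smul_mem' := by
    rintro c p ⟨φ, hφ, hp, hp'⟩
    refine ⟨c • φ, hφ.const_smul c, (Lp.coeFn_smul _ _).trans (hp.const_smul c), ?_⟩
    rw [classicalGrad_const_smul c hφ]
    exact (Lp.coeFn_smul _ _).trans (hp'.const_smul c)

/-- The Sobolev space `H¹₀(D; 𝕜)`: the closure of `C_c^∞(D; 𝕜)` in the `H¹` norm, an element being
stored together with its weak gradient, as a pair `(v, ∇v)`. Its instance norm is the `H¹` norm. -/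
def H10 (𝕜 : Type) [RCLike 𝕜] {d : ℕ} (D : Set (EuclideanSpace ℝ (Fin d))) :
    Submodule 𝕜 (L2Pair 𝕜 D) :=
  (testPairs 𝕜 D).topologicalClosure

/-- The weak gradient `∇v ∈ L²(D; 𝕜)ᵈ`. -/
def weakGrad {𝕜 : Type} [RCLike 𝕜] {d : ℕ} {D : Set (EuclideanSpace ℝ (Fin d))} (v : H10 𝕜 D) :
    Lp (EuclideanSpace 𝕜 (Fin d)) 2 (volume.restrict D) := (v : L2Pair 𝕜 D).snd

/-- The energy norm `‖v‖_V = ‖∇v‖_{L²(D)}` of `V = H¹₀(D)`. On a bounded `D` it is a norm,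
equivalent to the `H¹` norm. -/
def vNorm {𝕜 : Type} [RCLike 𝕜] {d : ℕ} {D : Set (EuclideanSpace ℝ (Fin d))}
    (v : H10 𝕜 D) : ℝ := ‖weakGrad v‖

/-- The dual norm `‖f‖_{V*} = sup {|f(v)| : ‖v‖_V ≤ 1}`. -/
def dualNorm {d : ℕ} {D : Set (EuclideanSpace ℝ (Fin d))} (f : H10 ℝ D →L[ℝ] ℝ) : ℝ :=
  ⨆ v : {v : H10 ℝ D // vNorm v ≤ 1}, |f v|

/-- The inclusion `ℝᵈ ⊆ ℂᵈ`. -/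
def vecOfReal (d : ℕ) : EuclideanSpace ℝ (Fin d) →L[ℝ] EuclideanSpace ℂ (Fin d) :=
  LinearMap.toContinuousLinearMap
    { toFun := fun z => WithLp.toLp 2 fun i => (z i : ℂ)
      map_add' := fun z w => by ext i; simp
      map_smul' := fun c z => by ext i; simp }

/-- The inclusion of pairs of real functions into pairs of complex functions. -/
def pairOfReal {d : ℕ} (D : Set (EuclideanSpace ℝ (Fin d))) (p : L2Pair ℝ D) : L2Pair ℂ D :=
  WithLp.toLp 2 (Complex.ofRealCLM.compLp p.fst, (vecOfReal d).compLp p.snd)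

theorem continuous_pairOfReal {d : ℕ} (D : Set (EuclideanSpace ℝ (Fin d))) :
    Continuous (pairOfReal D) := by
  have h1 : Continuous fun p : L2Pair ℝ D =>
      Complex.ofRealCLM.compLpL 2 (volume.restrict D) p.fst :=
    (ContinuousLinearMap.continuous _).comp (WithLp.continuous_fst _ _ _)
  have h2 : Continuous fun p : L2Pair ℝ D =>
      (vecOfReal d).compLpL 2 (volume.restrict D) p.snd :=
    (ContinuousLinearMap.continuous _).comp (WithLp.continuous_snd _ _ _)
  exact (WithLp.prod_continuous_toLp 2 _ _).comp (h1.prodMk h2)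

theorem pairOfReal_mem {d : ℕ} {D : Set (EuclideanSpace ℝ (Fin d))} (v : H10 ℝ D) :
    pairOfReal D v ∈ H10 ℂ D := by
  refine map_mem_closure (continuous_pairOfReal D) v.2 ?_
  rintro p ⟨φ, hφ, hp, hp'⟩
  refine ⟨fun x => (φ x : ℂ), hφ.ofReal, ?_, ?_⟩
  · filter_upwards [Complex.ofRealCLM.coeFn_compLp p.fst, hp] with x h1 h2
    rw [← h2]; exact h1
  · filter_upwards [(vecOfReal d).coeFn_compLp p.snd, hp'] with x h1 h2
    refine h1.trans ?_
    ext i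
    rw [classicalGrad_ofReal hφ, h2]
    rfl

/-- The inclusion `H¹₀(D; ℝ) ⊆ H¹₀(D; ℂ)`. -/
def toComplexH10 {d : ℕ} {D : Set (EuclideanSpace ℝ (Fin d))} (v : H10 ℝ D) : H10 ℂ D :=
  ⟨pairOfReal D v, pairOfReal_mem v⟩

/-- The complexification `W + iW ⊆ H¹₀(D; ℂ)` of a real subspace `W` of `H¹₀(D; ℝ)`. -/
def complexify {d : ℕ} {D : Set (EuclideanSpace ℝ (Fin d))} (W : Submodule ℝ (H10 ℝ D)) :
    Submodule ℂ (H10 ℂ D) :=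
  Submodule.span ℂ (toComplexH10 '' W)

/-- The affine diffusion coefficient `a(x, y) = a₀(x) + ∑ₘ yₘ aₘ(x)`, for real (`𝕜 = ℝ`) or complex
(`𝕜 = ℂ`) parameters `y`. -/
def diffCoeff {𝕜 : Type} [RCLike 𝕜] {d M : ℕ} (a₀ : EuclideanSpace ℝ (Fin d) → ℝ)
    (a : Fin M → EuclideanSpace ℝ (Fin d) → ℝ) (y : Fin M → 𝕜) (x : EuclideanSpace ℝ (Fin d)) : 𝕜 :=
  (a₀ x : 𝕜) + ∑ m, y m * (a m x : 𝕜)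

/-- The form `∫_D b ∇w · ∇v dx`, for `w` with values in `𝕜` and a real test function `v`. -/
def diffForm {𝕜 : Type} [RCLike 𝕜] {d : ℕ} {D : Set (EuclideanSpace ℝ (Fin d))}
    (b : EuclideanSpace ℝ (Fin d) → 𝕜) (w : H10 𝕜 D) (v : H10 ℝ D) : 𝕜 :=
  ∫ x in D, b x * ∑ i, weakGrad w x i * (weakGrad v x i : 𝕜)

/-- `w` satisfies the variational equation with coefficient `b`, right-hand side `f` and all test
functions from the subspace `W` of `V = H¹₀(D; ℝ)`. -/
def SolvesVariational {𝕜 : Type} [RCLike 𝕜] {d : ℕ} {D : Set (EuclideanSpace ℝ (Fin d))}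
    (b : EuclideanSpace ℝ (Fin d) → 𝕜) (f : H10 ℝ D →L[ℝ] ℝ) (W : Submodule ℝ (H10 ℝ D))
    (w : H10 𝕜 D) : Prop :=
  ∀ v ∈ W, diffForm b w v = (f v : 𝕜)

/-- The open polydisc `B_ℂ(0, ρ) = ∏ₘ B_ℂ(0, ρₘ)`. -/
def polydisc {M : ℕ} (ρ : Fin M → ℝ) : Set (Fin M → ℂ) := {y | ∀ m, ‖y m‖ < ρ m}

/-- The lower constant `inf_{x ∈ D} (a₀(x) - ∑ⱼ ρⱼ |aⱼ(x)|)` (`0` if unbounded below). -/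
def lowerConst {d M : ℕ} (D : Set (EuclideanSpace ℝ (Fin d)))
    (a₀ : EuclideanSpace ℝ (Fin d) → ℝ) (a : Fin M → EuclideanSpace ℝ (Fin d) → ℝ)
    (ρ : Fin M → ℝ) : ℝ :=
  ⨅ x : D, (a₀ x - ∑ j, ρ j * |a j x|)

/-- The weighted uniform ellipticity assumption: the lower constant is positive, and
`‖a‖_{L^∞(D × B_ℂ(0, ρ))}` is finite. -/
structure WeightedUEA {d M : ℕ} (D : Set (EuclideanSpace ℝ (Fin d)))
    (a₀ : EuclideanSpace ℝ (Fin d) → ℝ) (a : Fin M → EuclideanSpace ℝ (Fin d) → ℝ)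
    (ρ : Fin M → ℝ) : Prop where
  lower_pos : 0 < lowerConst D a₀ a ρ
  upper_lt_top : eLpNorm (fun p : EuclideanSpace ℝ (Fin d) × (Fin M → ℂ) => diffCoeff a₀ a p.2 p.1)
    ⊤ ((volume.restrict D).prod (volume.restrict (polydisc ρ))) < ⊤

end

/-!
Both the continuous problem and the Galerkin problems are instances of one problem on a closed
subspace `W` of `H¹₀(D; ℝ)` (all of it, or finite-dimensional), and `exists_holomorphic_solution`
treats this one.

Every element of `W + iW` is `p + i q` with `p, q ∈ W`, and `(p, q) ↦ p + i q` is an isometry up to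
equivalence of norms. So `W + iW` is complete (`isComplete_complexify`), and for `W = ⊤` it is all
of `H¹₀(D; ℂ)`, because it is closed and contains the test functions (`complexify_top`).

The Poincaré inequality makes the gradient norm equivalent to the `H¹` norm. It comes from
`∫ φ² = -∫ xᵢ · 2 φ ∂ᵢφ`, with `xᵢ` bounded on `D` (`exists_norm_le_mul_vNorm`).

On the polydisc `Re a(x, y) ≥ a₀(x) - ∑ ρₘ |aₘ(x)| ≥ c`, so the form `∫ a(·, y) ∇w · conj ∇v` is
coercive on `W + iW` and its operator `A(y)` is invertible. The Riesz representative `g` of `f` on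
`W` also represents the right-hand side on `W + iW`, so the solution is `u(y) = A(y)⁻¹ g`. The
coefficient is affine in `y` with values in `L^∞`, hence `A` is holomorphic, and so is `u`, since
inversion of operators is holomorphic (`exists_differentiableOn_solution`).

Testing with `u = p + i q` itself and taking real parts gives
`c ‖∇u‖² ≤ Re ⟪u, g⟫ = f(p) ≤ ‖f‖ ‖∇p‖ ≤ ‖f‖ ‖∇u‖`, which is the a priori bound. For real `y` the
real part `p` solves the real problem, hence the complex one, and uniqueness gives `u = p`.
-/

/-! ### Real and imaginary parts in `H¹₀(D; ℂ)` -/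

/-- The weak gradient as a continuous linear map. -/
noncomputable def weakGradL (𝕜 : Type) [RCLike 𝕜] {d : ℕ} (D : Set (EuclideanSpace ℝ (Fin d))) :
    H10 𝕜 D →L[𝕜] Lp (EuclideanSpace 𝕜 (Fin d)) 2 (volume.restrict D) :=
  (WithLp.sndL 2 𝕜 _ _).comp (H10 𝕜 D).subtypeL

/-- A real-linear map that turns a real inner product into a complex one does so on `L²` as well. -/
theorem inner_compLp_ofReal {α X Y : Type*} [MeasurableSpace α] {μ : Measure α}
    [NormedAddCommGroup X] [InnerProductSpace ℝ X] [NormedAddCommGroup Y] [InnerProductSpace ℂ Y]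
    (T : X →L[ℝ] Y) (hT : ∀ x y, inner ℂ (T x) (T y) = (inner ℝ x y : ℂ)) (p q : Lp X 2 μ) :
    inner ℂ (T.compLp p) (T.compLp q) = ((inner ℝ p q : ℝ) : ℂ) := by
  rw [L2.inner_def, L2.inner_def, ← integral_complex_ofReal]
  refine integral_congr_ae ?_
  filter_upwards [T.coeFn_compLp p, T.coeFn_compLp q] with x hp hq
  rw [hp, hq, hT]

theorem inner_vecOfReal {d : ℕ} (z w : EuclideanSpace ℝ (Fin d)) :
    inner ℂ (vecOfReal d z) (vecOfReal d w) = (inner ℝ z w : ℂ) := by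
  simp [PiLp.inner_apply, vecOfReal]

theorem norm_add_I_smul_sq {Y : Type*} [NormedAddCommGroup Y] [InnerProductSpace ℂ Y] {x y : Y}
    (h : (inner ℂ x y).im = 0) : ‖x + Complex.I • y‖ ^ 2 = ‖x‖ ^ 2 + ‖y‖ ^ 2 := by
  rw [norm_add_sq (𝕜 := ℂ), inner_smul_right, norm_smul]
  simp [h]

section Complexification

variable {d : ℕ} {D : Set (EuclideanSpace ℝ (Fin d))}

theorem inner_weakGrad_toComplexH10 (v w : H10 ℝ D) :
    inner ℂ (weakGrad (toComplexH10 v)) (weakGrad (toComplexH10 w)) =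
      ((inner ℝ (weakGrad v) (weakGrad w) : ℝ) : ℂ) :=
  inner_compLp_ofReal (vecOfReal d) inner_vecOfReal _ _

theorem inner_toComplexH10 (v w : H10 ℝ D) :
    inner ℂ (toComplexH10 v) (toComplexH10 w) = ((inner ℝ v w : ℝ) : ℂ) := by
  have h := inner_compLp_ofReal (μ := volume.restrict D) Complex.ofRealCLM (by simp)
    (v : L2Pair ℝ D).fst (w : L2Pair ℝ D).fst
  have h' := inner_weakGrad_toComplexH10 v w
  rw [Submodule.coe_inner, Submodule.coe_inner, WithLp.prod_inner_apply, WithLp.prod_inner_apply,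
    Complex.ofReal_add]
  exact congrArg₂ (· + ·) h h'

theorem norm_toComplexH10 (v : H10 ℝ D) : ‖toComplexH10 v‖ = ‖v‖ := by
  rw [norm_eq_sqrt_re_inner (𝕜 := ℂ), inner_toComplexH10, norm_eq_sqrt_real_inner]
  exact congrArg _ (Complex.ofReal_re _)

theorem vNorm_toComplexH10 (v : H10 ℝ D) : vNorm (toComplexH10 v) = vNorm v := by
  rw [vNorm, norm_eq_sqrt_re_inner (𝕜 := ℂ), inner_weakGrad_toComplexH10, vNorm,
    norm_eq_sqrt_real_inner]
  exact congrArg _ (Complex.ofReal_re _)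

theorem weakGrad_toComplexH10_ae (v : H10 ℝ D) :
    weakGrad (toComplexH10 v) =ᵐ[volume.restrict D] fun x => vecOfReal d (weakGrad v x) :=
  (vecOfReal d).coeFn_compLp _

theorem toComplexH10_add (v w : H10 ℝ D) :
    toComplexH10 (v + w) = toComplexH10 v + toComplexH10 w := by
  refine Subtype.ext (WithLp.ofLp_injective 2 (Prod.ext ?_ ?_))
  · exact map_add (Complex.ofRealCLM.compLpL 2 (volume.restrict D)) _ _
  · exact map_add ((vecOfReal d).compLpL 2 (volume.restrict D)) _ _

theorem toComplexH10_smul (r : ℝ) (v : H10 ℝ D) :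
    toComplexH10 (r • v) = (r : ℂ) • toComplexH10 v := by
  refine Subtype.ext (WithLp.ofLp_injective 2 (Prod.ext ?_ ?_))
  · exact map_smul (Complex.ofRealCLM.compLpL 2 (volume.restrict D)) r _
  · exact map_smul ((vecOfReal d).compLpL 2 (volume.restrict D)) r _

theorem toComplexH10_zero : toComplexH10 (0 : H10 ℝ D) = 0 := by
  simpa using toComplexH10_smul 0 (0 : H10 ℝ D)

theorem toComplexH10_sub (v w : H10 ℝ D) :
    toComplexH10 (v - w) = toComplexH10 v - toComplexH10 w := by
  rw [eq_sub_iff_add_eq, ← toComplexH10_add, sub_add_cancel]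

/-- The element `p + i q` of `H¹₀(D; ℂ)` with given real and imaginary parts. -/
noncomputable def mkComplexH10 (p q : H10 ℝ D) : H10 ℂ D :=
  toComplexH10 p + Complex.I • toComplexH10 q

theorem norm_mkComplexH10_sq (p q : H10 ℝ D) : ‖mkComplexH10 p q‖ ^ 2 = ‖p‖ ^ 2 + ‖q‖ ^ 2 := by
  have h : (inner ℂ (toComplexH10 p) (toComplexH10 q)).im = 0 := by
    rw [inner_toComplexH10, Complex.ofReal_im]
  rw [← norm_toComplexH10 p, ← norm_toComplexH10 q]
  exact norm_add_I_smul_sq h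

theorem vNorm_mkComplexH10_sq (p q : H10 ℝ D) :
    vNorm (mkComplexH10 p q) ^ 2 = vNorm p ^ 2 + vNorm q ^ 2 := by
  have h : weakGrad (mkComplexH10 p q) =
      weakGrad (toComplexH10 p) + Complex.I • weakGrad (toComplexH10 q) := rfl
  rw [vNorm, h, norm_add_I_smul_sq, ← vNorm_toComplexH10, ← vNorm_toComplexH10 q, vNorm, vNorm]
  rw [inner_weakGrad_toComplexH10, Complex.ofReal_im]

theorem mkComplexH10_sub (p q p' q' : H10 ℝ D) :
    mkComplexH10 (p - p') (q - q') = mkComplexH10 p q - mkComplexH10 p' q' := by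
  simp only [mkComplexH10, toComplexH10_sub, smul_sub]
  abel

theorem toComplexH10_mem_complexify {W : Submodule ℝ (H10 ℝ D)} {v : H10 ℝ D} (hv : v ∈ W) :
    toComplexH10 v ∈ complexify W :=
  Submodule.subset_span ⟨v, hv, rfl⟩

theorem mem_complexify_iff {W : Submodule ℝ (H10 ℝ D)} {w : H10 ℂ D} :
    w ∈ complexify W ↔ ∃ p ∈ W, ∃ q ∈ W, w = mkComplexH10 p q := by
  constructor
  · intro hw
    induction hw using Submodule.span_induction with
    | mem x hx =>
      obtain ⟨v, hv, rfl⟩ := hx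
      exact ⟨v, hv, 0, W.zero_mem, by simp [mkComplexH10, toComplexH10_zero]⟩
    | zero => exact ⟨0, W.zero_mem, 0, W.zero_mem, by simp [mkComplexH10, toComplexH10_zero]⟩
    | add x y _ _ hx hy =>
      obtain ⟨p, hp, q, hq, rfl⟩ := hx
      obtain ⟨p', hp', q', hq', rfl⟩ := hy
      refine ⟨p + p', W.add_mem hp hp', q + q', W.add_mem hq hq', ?_⟩
      simp only [mkComplexH10, toComplexH10_add, smul_add]
      abel
    | smul c x _ hx =>
      obtain ⟨p, hp, q, hq, rfl⟩ := hx
      refine ⟨c.re • p - c.im • q, W.sub_mem (W.smul_mem _ hp) (W.smul_mem _ hq),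
        c.re • q + c.im • p, W.add_mem (W.smul_mem _ hq) (W.smul_mem _ hp), ?_⟩
      simp only [mkComplexH10, toComplexH10_add, toComplexH10_sub, toComplexH10_smul]
      match_scalars <;> apply Complex.ext <;> simp
  · rintro ⟨p, hp, q, hq, rfl⟩
    exact add_mem (toComplexH10_mem_complexify hp)
      (Submodule.smul_mem _ _ (toComplexH10_mem_complexify hq))

/-- `(p, q) ↦ p + i q` is an isometry up to the factor between the Euclidean and the sup norm of a
pair. -/
theorem isUniformInducing_mkComplexH10 :
    IsUniformInducing fun x : H10 ℝ D × H10 ℝ D => mkComplexH10 x.1 x.2 := by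
  have hdist : ∀ x y : H10 ℝ D × H10 ℝ D,
      dist (mkComplexH10 x.1 x.2) (mkComplexH10 y.1 y.2) ^ 2 =
        dist x.1 y.1 ^ 2 + dist x.2 y.2 ^ 2 := fun x y => by
    rw [dist_eq_norm, dist_eq_norm, dist_eq_norm, ← mkComplexH10_sub, norm_mkComplexH10_sq]
  have hA : AntilipschitzWith 1 fun x : H10 ℝ D × H10 ℝ D => mkComplexH10 x.1 x.2 := by
    refine AntilipschitzWith.of_le_mul_dist fun x y => ?_
    rw [NNReal.coe_one, one_mul, Prod.dist_eq]
    have h := hdist x y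
    refine max_le ?_ ?_
    · exact (pow_le_pow_iff_left₀ dist_nonneg dist_nonneg two_ne_zero).1
        (by rw [h]; exact le_add_of_nonneg_right (sq_nonneg _))
    · exact (pow_le_pow_iff_left₀ dist_nonneg dist_nonneg two_ne_zero).1
        (by rw [h]; exact le_add_of_nonneg_left (sq_nonneg _))
  have hU : LipschitzWith 2 fun x : H10 ℝ D × H10 ℝ D => mkComplexH10 x.1 x.2 := by
    refine LipschitzWith.of_dist_le_mul fun x y => ?_
    have h := hdist x y
    have h1 : dist x.1 y.1 ≤ dist x y := le_max_left _ _
    have h2 : dist x.2 y.2 ≤ dist x y := le_max_right _ _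
    have n1 : 0 ≤ dist x.1 y.1 := dist_nonneg
    have n2 : 0 ≤ dist x.2 y.2 := dist_nonneg
    rw [NNReal.coe_ofNat]
    exact abs_le_of_sq_le_sq (by nlinarith) (by linarith) |> (le_abs_self _).trans
  exact hA.isUniformInducing hU.uniformContinuous

instance completeSpace_H10 {𝕜 : Type} [RCLike 𝕜] : CompleteSpace (H10 𝕜 D) :=
  (Submodule.isClosed_topologicalClosure _).completeSpace_coe

theorem isComplete_complexify {W : Submodule ℝ (H10 ℝ D)} (hW : IsClosed (W : Set (H10 ℝ D))) :
    IsComplete (complexify W : Set (H10 ℂ D)) := by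
  have hr : (complexify W : Set (H10 ℂ D)) =
      (fun x : H10 ℝ D × H10 ℝ D => mkComplexH10 x.1 x.2) ''
        (W ×ˢ W : Set (H10 ℝ D × H10 ℝ D)) := by
    ext w
    rw [SetLike.mem_coe, mem_complexify_iff]
    constructor
    · rintro ⟨p, hp, q, hq, rfl⟩
      exact ⟨(p, q), ⟨hp, hq⟩, rfl⟩
    · rintro ⟨x, hx, rfl⟩
      exact ⟨_, hx.1, _, hx.2, rfl⟩
  rw [hr]
  exact (isComplete_image_iff isUniformInducing_mkComplexH10).2 (hW.prod hW).isComplete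

theorem IsTestFunction.comp_real {φ : EuclideanSpace ℝ (Fin d) → ℂ} (hφ : IsTestFunction D φ)
    (L : ℂ →L[ℝ] ℝ) : IsTestFunction D (fun x => L (φ x)) where
  contDiff := L.contDiff.comp hφ.contDiff
  hasCompactSupport := hφ.hasCompactSupport.comp_left (map_zero L)
  tsupport_subset := (tsupport_comp_subset (map_zero L) φ).trans hφ.tsupport_subset

theorem classicalGrad_comp_real {φ : EuclideanSpace ℝ (Fin d) → ℂ} (hφ : IsTestFunction D φ)
    (L : ℂ →L[ℝ] ℝ) (x : EuclideanSpace ℝ (Fin d)) (i : Fin d) :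
    classicalGrad (fun x => L (φ x)) x i = L (classicalGrad φ x i) := by
  have h : fderiv ℝ (fun x => L (φ x)) x = L.comp (fderiv ℝ φ x) :=
    (L.hasFDerivAt.comp x (hφ.differentiable x).hasFDerivAt).fderiv
  simp [classicalGrad, h]

/-- A real-linear functional on `ℂ`, such as `re` or `im`, applied to each coordinate of `ℂᵈ`. -/
noncomputable def vecComp (d : ℕ) (L : ℂ →L[ℝ] ℝ) :
    EuclideanSpace ℂ (Fin d) →L[ℝ] EuclideanSpace ℝ (Fin d) :=
  LinearMap.toContinuousLinearMap
    { toFun := fun z => WithLp.toLp 2 fun i => L (z i)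
      map_add' := fun z w => by ext i; simp
      map_smul' := fun c z => by ext i; exact map_smul L c (z i) }

/-- A real-linear functional on `ℂ`, such as `re` or `im`, applied to a pair of complex
functions. -/
noncomputable def pairComp (L : ℂ →L[ℝ] ℝ) (p : L2Pair ℂ D) : L2Pair ℝ D :=
  WithLp.toLp 2 (L.compLp p.fst, (vecComp d L).compLp p.snd)

theorem pairComp_mem_testPairs (L : ℂ →L[ℝ] ℝ) {p : L2Pair ℂ D} (hp : p ∈ testPairs ℂ D) :
    pairComp L p ∈ testPairs ℝ D := by
  obtain ⟨φ, hφ, hp, hp'⟩ := hp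
  refine ⟨fun x => L (φ x), hφ.comp_real L, ?_, ?_⟩
  · filter_upwards [L.coeFn_compLp p.fst, hp] with x h1 h2
    rw [← h2]; exact h1
  · filter_upwards [(vecComp d L).coeFn_compLp p.snd, hp'] with x h1 h2
    refine h1.trans ?_
    ext i
    rw [classicalGrad_comp_real hφ, h2]
    rfl

theorem pairOfReal_pairComp_re_add_im (p : L2Pair ℂ D) :
    pairOfReal D (pairComp Complex.reCLM p) + Complex.I • pairOfReal D (pairComp Complex.imCLM p)
      = p := by
  refine WithLp.ofLp_injective 2 (Prod.ext ?_ ?_)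
  · change Complex.ofRealCLM.compLp (Complex.reCLM.compLp p.fst) +
      Complex.I • Complex.ofRealCLM.compLp (Complex.imCLM.compLp p.fst) = p.fst
    refine Lp.ext ?_
    filter_upwards [Lp.coeFn_add (Complex.ofRealCLM.compLp (Complex.reCLM.compLp p.fst))
        (Complex.I • Complex.ofRealCLM.compLp (Complex.imCLM.compLp p.fst)),
      Lp.coeFn_smul Complex.I (Complex.ofRealCLM.compLp (Complex.imCLM.compLp p.fst)),
      Complex.ofRealCLM.coeFn_compLp (Complex.reCLM.compLp p.fst),
      Complex.ofRealCLM.coeFn_compLp (Complex.imCLM.compLp p.fst),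
      Complex.reCLM.coeFn_compLp p.fst, Complex.imCLM.coeFn_compLp p.fst] with x h1 h2 h3 h4 h5 h6
    rw [h1, Pi.add_apply, h2, Pi.smul_apply, h3, h4, h5, h6]
    simpa [mul_comm] using Complex.re_add_im (p.fst x)
  · change (vecOfReal d).compLp ((vecComp d Complex.reCLM).compLp p.snd) +
      Complex.I • (vecOfReal d).compLp ((vecComp d Complex.imCLM).compLp p.snd) = p.snd
    refine Lp.ext ?_
    filter_upwards [Lp.coeFn_add ((vecOfReal d).compLp ((vecComp d Complex.reCLM).compLp p.snd))
        (Complex.I • (vecOfReal d).compLp ((vecComp d Complex.imCLM).compLp p.snd)),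
      Lp.coeFn_smul Complex.I ((vecOfReal d).compLp ((vecComp d Complex.imCLM).compLp p.snd)),
      (vecOfReal d).coeFn_compLp ((vecComp d Complex.reCLM).compLp p.snd),
      (vecOfReal d).coeFn_compLp ((vecComp d Complex.imCLM).compLp p.snd),
      (vecComp d Complex.reCLM).coeFn_compLp p.snd,
      (vecComp d Complex.imCLM).coeFn_compLp p.snd] with x h1 h2 h3 h4 h5 h6
    rw [h1, Pi.add_apply, h2, Pi.smul_apply, h3, h4, h5, h6]
    ext i
    simpa [mul_comm, vecComp, vecOfReal] using Complex.re_add_im (p.snd x i)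

/-- `H¹₀(D; ℂ) = H¹₀(D; ℝ) + i H¹₀(D; ℝ)`: the right-hand side is closed and contains the test
functions. -/
theorem complexify_top : complexify (⊤ : Submodule ℝ (H10 ℝ D)) = ⊤ := by
  have hcl : IsComplete (((complexify (⊤ : Submodule ℝ (H10 ℝ D))).map
      (H10 ℂ D).subtype : Submodule ℂ (L2Pair ℂ D)) : Set (L2Pair ℂ D)) := by
    rw [Submodule.map_coe]
    exact (isComplete_image_iff isUniformEmbedding_subtype_val.isUniformInducing).2
      (isComplete_complexify isClosed_univ)
  have hle : H10 ℂ D ≤ (complexify (⊤ : Submodule ℝ (H10 ℝ D))).map (H10 ℂ D).subtype := by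
    refine Submodule.topologicalClosure_minimal _ ?_ hcl.isClosed
    intro p hp
    have hmem : ∀ L : ℂ →L[ℝ] ℝ, pairComp L p ∈ H10 ℝ D := fun L =>
      Submodule.le_topologicalClosure _ (pairComp_mem_testPairs L hp)
    refine ⟨mkComplexH10 ⟨_, hmem Complex.reCLM⟩ ⟨_, hmem Complex.imCLM⟩,
      mem_complexify_iff.2 ⟨_, trivial, _, trivial, rfl⟩, ?_⟩
    exact pairOfReal_pairComp_re_add_im p
  rw [eq_top_iff]
  rintro w -
  obtain ⟨w', hw', h⟩ := hle w.2
  rwa [← Subtype.ext h]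

end Complexification

/-! ### The Poincaré inequality -/

/-- Integration by parts of `φ²` against the coordinate `xᵢ`, whose derivative in direction `i`
is `1`. -/
theorem integral_sq_eq_integral_coord_mul {d : ℕ} {D : Set (EuclideanSpace ℝ (Fin d))}
    {φ : EuclideanSpace ℝ (Fin d) → ℝ} (hφ : IsTestFunction D φ) (i : Fin d) :
    ∫ x, φ x ^ 2 = -∫ x, x i * (2 * φ x * classicalGrad φ x i) := by
  have hd : Differentiable ℝ φ := hφ.differentiable
  have hc : Continuous φ := hφ.contDiff.continuous
  have hc' : Continuous fun x => fderiv ℝ φ x (EuclideanSpace.single i 1) :=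
    (hφ.contDiff.continuous_fderiv (by simp)).clm_apply continuous_const
  have hproj : Continuous fun x : EuclideanSpace ℝ (Fin d) => x i := by fun_prop
  have hsq : HasCompactSupport fun x => φ x ^ 2 :=
    hφ.hasCompactSupport.comp_left (g := fun t => t ^ 2) (by simp)
  have hφ2 : ∀ x, HasFDerivAt (fun x => φ x ^ 2) ((2 * φ x) • fderiv ℝ φ x) x := fun x => by
    simpa using (hd x).hasFDerivAt.pow 2
  have hx : ∀ x, HasFDerivAt (fun x : EuclideanSpace ℝ (Fin d) => x i)
      (EuclideanSpace.proj i : EuclideanSpace ℝ (Fin d) →L[ℝ] ℝ) x := fun x =>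
    (EuclideanSpace.proj i : EuclideanSpace ℝ (Fin d) →L[ℝ] ℝ).hasFDerivAt
  have key := integral_bilinear_hasFDerivAt_right_eq_neg_left_of_integrable
    (μ := (volume : Measure (EuclideanSpace ℝ (Fin d)))) (B := ContinuousLinearMap.mul ℝ ℝ)
    (v := EuclideanSpace.single i 1) (f := fun x : EuclideanSpace ℝ (Fin d) => x i)
    (g := fun x => φ x ^ 2) (hf := fun x _ => hx x) (hg := fun x _ => hφ2 x) ?_ ?_ ?_
  · simp only [ContinuousLinearMap.mul_apply', PiLp.proj_apply, PiLp.single_apply, if_true,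
      one_mul, smul_eq_mul, smul_apply] at key
    rw [← neg_eq_iff_eq_neg, ← key]
    rfl
  · refine Continuous.integrable_of_hasCompactSupport (by fun_prop) ?_
    simpa using hsq
  · refine Continuous.integrable_of_hasCompactSupport ?_ ?_
    · simp only [ContinuousLinearMap.mul_apply', smul_apply, smul_eq_mul]
      fun_prop
    · refine hφ.hasCompactSupport.mono fun x hx h => hx ?_
      simp [h]
  · refine Continuous.integrable_of_hasCompactSupport ?_ ?_
    · simp only [ContinuousLinearMap.mul_apply']; fun_prop
    · exact hsq.mul_left

theorem classicalGrad_eq_zero_of_notMem_tsupport {d : ℕ} {φ : EuclideanSpace ℝ (Fin d) → ℝ}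
    {x : EuclideanSpace ℝ (Fin d)} (hx : x ∉ tsupport φ) : classicalGrad φ x = 0 := by
  have h0 : fderiv ℝ φ x = 0 := by
    by_contra h
    exact hx (support_fderiv_subset ℝ h)
  ext j
  simp [classicalGrad, h0]

theorem IsTestFunction.continuous_classicalGrad_apply {d : ℕ}
    {D : Set (EuclideanSpace ℝ (Fin d))} {φ : EuclideanSpace ℝ (Fin d) → ℝ}
    (hφ : IsTestFunction D φ) (i : Fin d) : Continuous fun x => classicalGrad φ x i :=
  (hφ.contDiff.continuous_fderiv (by simp)).clm_apply continuous_const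

theorem IsTestFunction.integrable_sq {d : ℕ} {D : Set (EuclideanSpace ℝ (Fin d))}
    {φ : EuclideanSpace ℝ (Fin d) → ℝ} (hφ : IsTestFunction D φ) :
    Integrable fun x => φ x ^ 2 := by
  have hc : Continuous φ := hφ.contDiff.continuous
  refine Continuous.integrable_of_hasCompactSupport (by fun_prop)
    (HasCompactSupport.intro hφ.hasCompactSupport fun x hx => ?_)
  rw [image_eq_zero_of_notMem_tsupport hx, zero_pow two_ne_zero]

theorem IsTestFunction.integrable_norm_classicalGrad_sq {d : ℕ}
    {D : Set (EuclideanSpace ℝ (Fin d))} {φ : EuclideanSpace ℝ (Fin d) → ℝ}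
    (hφ : IsTestFunction D φ) : Integrable fun x => ‖classicalGrad φ x‖ ^ 2 := by
  have hcg : Continuous fun x => ‖classicalGrad φ x‖ ^ 2 := by
    simp only [EuclideanSpace.norm_sq_eq, Real.norm_eq_abs, sq_abs]
    exact continuous_finsetSum _ fun j _ => (hφ.continuous_classicalGrad_apply j).pow 2
  refine hcg.integrable_of_hasCompactSupport (HasCompactSupport.intro hφ.hasCompactSupport ?_)
  intro x hx
  rw [classicalGrad_eq_zero_of_notMem_tsupport hx, norm_zero, zero_pow two_ne_zero]

/-- Young's inequality, in the form that absorbs half of `t ^ 2`. -/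
theorem neg_mul_le_half_sq_add {s t g G R : ℝ} (hs : |s| ≤ R) (hg : g ^ 2 ≤ G) :
    -(s * (2 * t * g)) ≤ 1 / 2 * t ^ 2 + 2 * R ^ 2 * G := by
  have h2 : s ^ 2 ≤ R ^ 2 := sq_le_sq' (abs_le.1 hs).1 (abs_le.1 hs).2
  have h3 : (s * g) ^ 2 ≤ R ^ 2 * G := by
    rw [mul_pow]
    exact mul_le_mul h2 hg (sq_nonneg _) (sq_nonneg _)
  linarith [sq_nonneg (t + 2 * (s * g))]

/-- The Poincaré inequality for test functions. -/
theorem integral_sq_le_integral_classicalGrad {d : ℕ} {D : Set (EuclideanSpace ℝ (Fin d))}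
    {φ : EuclideanSpace ℝ (Fin d) → ℝ} (hφ : IsTestFunction D φ) (i : Fin d) {R : ℝ}
    (hR : ∀ x ∈ D, ‖x‖ ≤ R) :
    ∫ x, φ x ^ 2 ≤ 4 * R ^ 2 * ∫ x, ‖classicalGrad φ x‖ ^ 2 := by
  have hc : Continuous φ := hφ.contDiff.continuous
  have hint3 : Integrable fun x => x i * (2 * φ x * classicalGrad φ x i) := by
    refine Continuous.integrable_of_hasCompactSupport ?_ ?_
    · have := hφ.continuous_classicalGrad_apply i
      fun_prop
    · refine HasCompactSupport.intro hφ.hasCompactSupport fun x hx => ?_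
      rw [image_eq_zero_of_notMem_tsupport hx, mul_zero, zero_mul, mul_zero]
  have hpt : ∀ x, -(x i * (2 * φ x * classicalGrad φ x i)) ≤
      1 / 2 * φ x ^ 2 + 2 * R ^ 2 * ‖classicalGrad φ x‖ ^ 2 := fun x => by
    have hi : classicalGrad φ x i ^ 2 ≤ ‖classicalGrad φ x‖ ^ 2 :=
      sq_le_sq' (neg_le_of_abs_le (PiLp.norm_apply_le (classicalGrad φ x) i))
        ((le_abs_self _).trans (PiLp.norm_apply_le (classicalGrad φ x) i))
    by_cases hx : x ∈ D
    · exact neg_mul_le_half_sq_add ((PiLp.norm_apply_le x i).trans (hR x hx)) hi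
    · rw [image_eq_zero_of_notMem_tsupport fun h => hx (hφ.tsupport_subset h)]
      have : 0 ≤ 2 * R ^ 2 * ‖classicalGrad φ x‖ ^ 2 := by positivity
      linarith
  have hle := integral_mono hint3.neg
    ((hφ.integrable_sq.const_mul (1 / 2)).add
      (hφ.integrable_norm_classicalGrad_sq.const_mul (2 * R ^ 2))) hpt
  rw [integral_neg'] at hle
  simp only [Pi.add_apply] at hle
  rw [integral_add (hφ.integrable_sq.const_mul _)
    (hφ.integrable_norm_classicalGrad_sq.const_mul _), integral_const_mul,
    integral_const_mul, ← integral_sq_eq_integral_coord_mul hφ i] at hle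
  linarith

theorem norm_sq_eq_integral {α X : Type*} [MeasurableSpace α] {μ : Measure α}
    [NormedAddCommGroup X] [InnerProductSpace ℝ X] (p : Lp X 2 μ) :
    ‖p‖ ^ 2 = ∫ x, ‖p x‖ ^ 2 ∂μ := by
  rw [← real_inner_self_eq_norm_sq, L2.inner_def]
  simp

/-- The Poincaré inequality on `H¹₀(D; ℝ)`, for the full `H¹` norm: the inequality for test
functions is a closed condition. -/
theorem exists_norm_le_mul_vNorm {d : ℕ} (hd : 0 < d) {D : Set (EuclideanSpace ℝ (Fin d))}
    (hD : Bornology.IsBounded D) :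
    ∃ C : ℝ, 0 < C ∧ ∀ v : H10 ℝ D, ‖v‖ ≤ C * vNorm v := by
  obtain ⟨R, hR⟩ := hD.exists_norm_le
  have htest : ∀ p ∈ testPairs ℝ D, ‖p.fst‖ ^ 2 ≤ 4 * R ^ 2 * ‖p.snd‖ ^ 2 := by
    rintro p ⟨φ, hφ, hp, hp'⟩
    have h0 : ∀ x, x ∉ D → x ∉ tsupport φ := fun x hx h => hx (hφ.tsupport_subset h)
    have h1 : ‖p.fst‖ ^ 2 = ∫ x, φ x ^ 2 := by
      rw [norm_sq_eq_integral, ← setIntegral_eq_integral_of_forall_compl_eq_zero (s := D)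
        (f := fun x => φ x ^ 2)]
      · refine integral_congr_ae ?_
        filter_upwards [hp] with x hx
        rw [hx, Real.norm_eq_abs, sq_abs]
      · intro x hx
        simp [image_eq_zero_of_notMem_tsupport (h0 x hx)]
    have h2 : ‖p.snd‖ ^ 2 = ∫ x, ‖classicalGrad φ x‖ ^ 2 := by
      rw [norm_sq_eq_integral, ← setIntegral_eq_integral_of_forall_compl_eq_zero (s := D)
        (f := fun x => ‖classicalGrad φ x‖ ^ 2)]
      · refine integral_congr_ae ?_
        filter_upwards [hp'] with x hx
        rw [hx]
      · intro x hx
        simp [classicalGrad_eq_zero_of_notMem_tsupport (h0 x hx)]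
    rw [h1, h2]
    exact integral_sq_le_integral_classicalGrad hφ ⟨0, hd⟩ hR
  have hclosed : IsClosed {p : L2Pair ℝ D | ‖p.fst‖ ^ 2 ≤ 4 * R ^ 2 * ‖p.snd‖ ^ 2} :=
    isClosed_le ((WithLp.continuous_fst _ _ _).norm.pow 2)
      (continuous_const.mul ((WithLp.continuous_snd _ _ _).norm.pow 2))
  have hC : 0 < 4 * R ^ 2 + 1 := by positivity
  refine ⟨√(4 * R ^ 2 + 1), Real.sqrt_pos.2 hC, fun v => ?_⟩
  have hv : ‖(v : L2Pair ℝ D).fst‖ ^ 2 ≤ 4 * R ^ 2 * ‖(v : L2Pair ℝ D).snd‖ ^ 2 :=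
    closure_minimal htest hclosed v.2
  have hn : ‖v‖ ^ 2 = ‖(v : L2Pair ℝ D).fst‖ ^ 2 + ‖(v : L2Pair ℝ D).snd‖ ^ 2 :=
    WithLp.prod_norm_sq_eq_of_L2 (v : L2Pair ℝ D)
  refine (pow_le_pow_iff_left₀ (norm_nonneg _)
    (mul_nonneg (Real.sqrt_nonneg _) (norm_nonneg _)) two_ne_zero).1 ?_
  have hw : ‖weakGrad v‖ = ‖(v : L2Pair ℝ D).snd‖ := rfl
  rw [mul_pow, Real.sq_sqrt hC.le, hn, hw]
  linarith

theorem norm_mkComplexH10_le {d : ℕ} {D : Set (EuclideanSpace ℝ (Fin d))} {C : ℝ}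
    (hC : ∀ v : H10 ℝ D, ‖v‖ ≤ C * vNorm v) (p q : H10 ℝ D) :
    ‖mkComplexH10 p q‖ ^ 2 ≤ C ^ 2 * vNorm (mkComplexH10 p q) ^ 2 := by
  have hsq : ∀ v : H10 ℝ D, ‖v‖ ^ 2 ≤ C ^ 2 * vNorm v ^ 2 := fun v => by
    rw [← mul_pow]; exact pow_le_pow_left₀ (norm_nonneg _) (hC v) 2
  rw [norm_mkComplexH10_sq, vNorm_mkComplexH10_sq, mul_add]
  exact add_le_add (hsq p) (hsq q)

/-- By the Poincaré inequality the supremum that defines the dual norm is one of a bounded set, and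
`vNorm v = 0` only for `v = 0`. -/
theorem le_dualNorm_mul_vNorm {d : ℕ} {D : Set (EuclideanSpace ℝ (Fin d))} {C : ℝ}
    (hC0 : 0 < C) (hC : ∀ v : H10 ℝ D, ‖v‖ ≤ C * vNorm v) (f : H10 ℝ D →L[ℝ] ℝ) (v : H10 ℝ D) :
    |f v| ≤ dualNorm f * vNorm v := by
  have hbdd : BddAbove (range fun w : {w : H10 ℝ D // vNorm w ≤ 1} => |f w|) := by
    refine ⟨‖f‖ * C, ?_⟩
    rintro _ ⟨w, rfl⟩
    refine (f.le_opNorm w).trans (mul_le_mul_of_nonneg_left ?_ (norm_nonneg f))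
    exact (hC w).trans (mul_le_of_le_one_right hC0.le w.2)
  rcases eq_or_ne (vNorm v) 0 with h0 | h0
  · have hv : v = 0 := by
      have := hC v
      rw [h0, mul_zero] at this
      exact norm_le_zero_iff.1 this
    subst hv
    simp [h0]
  · have hpos : 0 < vNorm v := lt_of_le_of_ne (norm_nonneg _) (Ne.symm h0)
    have hs : vNorm ((vNorm v)⁻¹ • v) = 1 := by
      have : vNorm ((vNorm v)⁻¹ • v) = ‖(vNorm v)⁻¹ • weakGrad v‖ := rfl
      rw [this, norm_smul, Real.norm_of_nonneg (inv_nonneg.2 hpos.le)]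
      exact inv_mul_cancel₀ h0
    have h := le_ciSup hbdd ⟨(vNorm v)⁻¹ • v, hs.le⟩
    simp only [map_smul, smul_eq_mul, abs_mul, abs_inv, abs_of_pos hpos] at h
    rw [← div_le_iff₀ hpos, div_eq_inv_mul]
    exact h

/-! ### The diffusion form -/

section DiffusionForm

variable {d : ℕ} {D : Set (EuclideanSpace ℝ (Fin d))}

/-- Multiplication of an `L²` vector field by an `L^∞` coefficient, as a continuous bilinear map. -/
noncomputable def mulFieldL (D : Set (EuclideanSpace ℝ (Fin d))) :
    Lp ℂ ⊤ (volume.restrict D) →L[ℂ]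
      Lp (EuclideanSpace ℂ (Fin d)) 2 (volume.restrict D) →L[ℂ]
        Lp (EuclideanSpace ℂ (Fin d)) 2 (volume.restrict D) :=
  (ContinuousLinearMap.lsmul ℂ ℂ).holderL (volume.restrict D) ⊤ 2 2

theorem mulFieldL_ae (b : Lp ℂ ⊤ (volume.restrict D))
    (g : Lp (EuclideanSpace ℂ (Fin d)) 2 (volume.restrict D)) :
    mulFieldL D b g =ᵐ[volume.restrict D] fun x => b x • g x :=
  (ContinuousLinearMap.lsmul ℂ ℂ).coeFn_holder b g

theorem diffForm_eq_inner {b : Lp ℂ ⊤ (volume.restrict D)} {b' : EuclideanSpace ℝ (Fin d) → ℂ}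
    (hb : b =ᵐ[volume.restrict D] b') (w : H10 ℂ D) (v : H10 ℝ D) :
    diffForm b' w v = inner ℂ (weakGrad (toComplexH10 v)) (mulFieldL D b (weakGrad w)) := by
  rw [L2.inner_def, diffForm]
  refine integral_congr_ae ?_
  filter_upwards [hb, mulFieldL_ae b (weakGrad w), weakGrad_toComplexH10_ae v] with x h1 h2 h3
  rw [h2, h3, h1, inner_smul_right]
  congr 1
  simp [PiLp.inner_apply, vecOfReal]

theorem le_re_inner_mulFieldL {b : Lp ℂ ⊤ (volume.restrict D)} {c : ℝ}
    (hb : ∀ᵐ x ∂volume.restrict D, c ≤ (b x).re)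
    (g : Lp (EuclideanSpace ℂ (Fin d)) 2 (volume.restrict D)) :
    c * ‖g‖ ^ 2 ≤ (inner ℂ g (mulFieldL D b g)).re := by
  have h1 : c * ‖g‖ ^ 2 = (inner ℂ g ((c : ℂ) • g)).re := by
    rw [inner_smul_right, Complex.re_ofReal_mul, ← inner_self_eq_norm_sq (𝕜 := ℂ)]
    rfl
  have h2 : ∀ h : Lp (EuclideanSpace ℂ (Fin d)) 2 (volume.restrict D),
      (inner ℂ g h).re = ∫ x in D, (inner ℂ (g x) (h x)).re := fun h => by
    rw [L2.inner_def]
    exact (integral_re (L2.integrable_inner (𝕜 := ℂ) g h)).symm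
  rw [h1, h2, h2]
  refine integral_mono_ae (L2.integrable_inner (𝕜 := ℂ) g _).re
    (L2.integrable_inner (𝕜 := ℂ) g _).re ?_
  filter_upwards [hb, mulFieldL_ae b g, Lp.coeFn_smul (c : ℂ) g] with x hx h3 h4
  rw [h3, h4, Pi.smul_apply, inner_smul_right, inner_smul_right, inner_self_eq_norm_sq_to_K]
  have h5 : ((‖g x‖ : ℂ) ^ 2) = ((‖g x‖ ^ 2 : ℝ) : ℂ) := by push_cast; rfl
  change ((c : ℂ) * (‖g x‖ : ℂ) ^ 2).re ≤ (b x * (‖g x‖ : ℂ) ^ 2).re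
  rw [h5, Complex.re_mul_ofReal, Complex.re_mul_ofReal, Complex.ofReal_re]
  exact mul_le_mul_of_nonneg_right hx (sq_nonneg _)

end DiffusionForm

/-! ### The affine coefficient -/

section Coefficient

variable {d M : ℕ} {D : Set (EuclideanSpace ℝ (Fin d))}
  {a₀ : EuclideanSpace ℝ (Fin d) → ℝ} {a : Fin M → EuclideanSpace ℝ (Fin d) → ℝ} {ρ : Fin M → ℝ}

theorem WeightedUEA.lowerConst_le (h : WeightedUEA D a₀ a ρ) {x : EuclideanSpace ℝ (Fin d)}
    (hx : x ∈ D) : lowerConst D a₀ a ρ + ∑ m, ρ m * |a m x| ≤ a₀ x := by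
  -- an infimum over a set that is not bounded below would be `0`, hence not positive
  have hbdd : BddBelow (range fun x : D => a₀ x - ∑ j, ρ j * |a j x|) := by
    by_contra hb
    have h0 := h.lower_pos
    rw [lowerConst, Real.iInf_of_not_bddBelow hb] at h0
    exact lt_irrefl _ h0
  have := ciInf_le hbdd ⟨x, hx⟩
  rw [← le_sub_iff_add_le]
  exact this

theorem isOpen_polydisc (ρ : Fin M → ℝ) : IsOpen (polydisc ρ) := by
  have h : polydisc ρ = ⋂ m, {y : Fin M → ℂ | ‖y m‖ < ρ m} := by
    ext y; simp [polydisc]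
  rw [h]
  exact isOpen_iInter_of_finite fun m => isOpen_lt (continuous_apply m).norm continuous_const

/-- The `L^∞` bound on `D × B_ℂ(0, ρ)` passes to the slice `y = 0` by continuity in `y`, and the
lower bound dominates every `|aₘ|` by `a₀`. -/
theorem WeightedUEA.exists_bound (h : WeightedUEA D a₀ a ρ) (hD : MeasurableSet D)
    (hρ : ∀ m, 1 < ρ m) :
    ∃ B : ℝ, ∀ᵐ x ∂volume.restrict D, |a₀ x| ≤ B ∧ ∀ m, |a m x| ≤ B := by
  set F : EuclideanSpace ℝ (Fin d) × (Fin M → ℂ) → ℂ := fun p => diffCoeff a₀ a p.2 p.1 with hF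
  set N := eLpNorm F ⊤ ((volume.restrict D).prod (volume.restrict (polydisc ρ))) with hN
  have hae : ∀ᵐ p ∂(volume.restrict D).prod (volume.restrict (polydisc ρ)), ‖F p‖ ≤ N.toReal := by
    have := ae_le_eLpNormEssSup (f := F)
      (μ := (volume.restrict D).prod (volume.restrict (polydisc ρ)))
    filter_upwards [this] with p hp
    rw [← eLpNorm_exponent_top, ← ofReal_norm] at hp
    exact (ENNReal.ofReal_le_iff_le_toReal h.upper_lt_top.ne).1 hp
  refine ⟨N.toReal, ?_⟩
  filter_upwards [Measure.ae_ae_of_ae_prod hae, ae_restrict_mem hD] with x hx hxD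
  have hlow := h.lowerConst_le hxD
  have hsum : ∀ m, |a m x| ≤ ∑ j, ρ j * |a j x| := fun m => by
    have h1 : ρ m * |a m x| ≤ ∑ j, ρ j * |a j x| :=
      Finset.single_le_sum (f := fun j => ρ j * |a j x|)
        (fun j _ => mul_nonneg (zero_le_one.trans (hρ j).le) (abs_nonneg _)) (Finset.mem_univ m)
    exact (le_mul_of_one_le_left (abs_nonneg _) (hρ m).le).trans h1
  have hsum0 : 0 ≤ ∑ j, ρ j * |a j x| := Finset.sum_nonneg fun j _ =>
    mul_nonneg (zero_le_one.trans (hρ j).le) (abs_nonneg _)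
  have ha0 : 0 ≤ a₀ x := (add_nonneg h.lower_pos.le hsum0).trans hlow
  have hmain : a₀ x ≤ N.toReal := by
    by_contra! hlt
    have hcont : Continuous fun y : Fin M → ℂ => ‖F (x, y)‖ := by
      simp only [hF, diffCoeff]
      fun_prop
    have hopen : IsOpen (polydisc ρ ∩ {y | N.toReal < ‖F (x, y)‖}) :=
      (isOpen_polydisc ρ).inter (isOpen_lt continuous_const hcont)
    have hne : (polydisc ρ ∩ {y | N.toReal < ‖F (x, y)‖}).Nonempty := by
      refine ⟨0, fun m => by simpa using zero_lt_one.trans (hρ m), ?_⟩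
      simpa [hF, diffCoeff, abs_of_nonneg ha0] using hlt
    refine (hopen.measure_pos volume hne).ne' ?_
    rw [ae_restrict_iff' (isOpen_polydisc ρ).measurableSet] at hx
    refine measure_mono_null ?_ (ae_iff.1 hx)
    rintro y ⟨hy, hy'⟩ hle
    exact absurd (hle hy) (not_le.2 hy')
  refine ⟨by rwa [abs_of_nonneg ha0], fun m => ?_⟩
  linarith [hsum m, h.lower_pos]

/-- On the polydisc the perturbation of `a₀` is at most `∑ ρₘ |aₘ|`, so the real part of the
coefficient is bounded below by the ellipticity constant. -/
theorem WeightedUEA.le_re_diffCoeff (h : WeightedUEA D a₀ a ρ) {y : Fin M → ℂ}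
    (hy : y ∈ polydisc ρ) {x : EuclideanSpace ℝ (Fin d)} (hx : x ∈ D) :
    lowerConst D a₀ a ρ ≤ (diffCoeff a₀ a y x).re := by
  have h1 := h.lowerConst_le hx
  have h2 : -∑ m, ρ m * |a m x| ≤ (∑ m, y m * (a m x : ℂ)).re := by
    rw [Complex.re_sum, ← Finset.sum_neg_distrib]
    refine Finset.sum_le_sum fun m _ => ?_
    refine neg_le_of_abs_le ((Complex.abs_re_le_norm _).trans ?_)
    rw [norm_mul, Complex.norm_real, Real.norm_eq_abs]
    exact mul_le_mul_of_nonneg_right (hy m).le (abs_nonneg _)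
  change _ ≤ ((a₀ x : ℂ) + ∑ m, y m * (a m x : ℂ)).re
  rw [Complex.add_re, Complex.ofReal_re]
  linarith

/-- The coefficient depends holomorphically on the parameter, as an element of `L^∞`. -/
theorem WeightedUEA.exists_coeff (h : WeightedUEA D a₀ a ρ) (hD : MeasurableSet D)
    (hρ : ∀ m, 1 < ρ m) (ha₀ : AEStronglyMeasurable a₀ (volume.restrict D))
    (ha : ∀ m, AEStronglyMeasurable (a m) (volume.restrict D)) :
    ∃ b : (Fin M → ℂ) → Lp ℂ ⊤ (volume.restrict D), Differentiable ℂ b ∧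
      ∀ y, b y =ᵐ[volume.restrict D] diffCoeff a₀ a y := by
  obtain ⟨B, hB⟩ := h.exists_bound hD hρ
  have h0 : MemLp (fun x => (a₀ x : ℂ)) ⊤ (volume.restrict D) :=
    memLp_top_of_bound (Complex.continuous_ofReal.comp_aestronglyMeasurable ha₀) B <| by
      filter_upwards [hB] with x hx
      simpa using hx.1
  have h1 : ∀ m, MemLp (fun x => (a m x : ℂ)) ⊤ (volume.restrict D) := fun m =>
    memLp_top_of_bound (Complex.continuous_ofReal.comp_aestronglyMeasurable (ha m)) B <| by
      filter_upwards [hB] with x hx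
      simpa using hx.2 m
  have hsum : ∀ y : Fin M → ℂ, MemLp (fun x => ∑ m, y m * (a m x : ℂ)) ⊤ (volume.restrict D) :=
    fun y => memLp_finsetSum _ fun m _ => (h1 m).const_mul (y m)
  refine ⟨fun y => h0.toLp + ∑ m, y m • (h1 m).toLp, by fun_prop, fun y => ?_⟩
  have hs : (∑ m, y m • (h1 m).toLp : Lp ℂ ⊤ (volume.restrict D)) =ᵐ[volume.restrict D]
      fun x => ∑ m, y m * (a m x : ℂ) := by
    refine (Lp.coeFn_finsetSum _ _).trans ?_
    have hm : ∀ᵐ x ∂volume.restrict D, ∀ m, (y m • (h1 m).toLp : Lp ℂ ⊤ (volume.restrict D)) x =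
        y m * (a m x : ℂ) := ae_all_iff.2 fun m => by
      filter_upwards [Lp.coeFn_smul (y m) (h1 m).toLp, (h1 m).coeFn_toLp] with x h2 h3
      rw [h2, Pi.smul_apply, h3, smul_eq_mul]
    filter_upwards [hm] with x hx
    simp [hx]
  filter_upwards [Lp.coeFn_add h0.toLp (∑ m, y m • (h1 m).toLp), h0.coeFn_toLp, hs] with x h2 h3 h4
  rw [h2, Pi.add_apply, h3, h4]
  rfl

theorem diffForm_toComplexH10 (y : Fin M → ℝ) (p v : H10 ℝ D) :
    diffForm (diffCoeff a₀ a fun m => (y m : ℂ)) (toComplexH10 p) v =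
      ((diffForm (diffCoeff a₀ a y) p v : ℝ) : ℂ) := by
  rw [diffForm, diffForm, ← integral_complex_ofReal]
  refine integral_congr_ae ?_
  filter_upwards [weakGrad_toComplexH10_ae p] with x hx
  rw [hx]
  simp [diffCoeff, vecOfReal]

end Coefficient

/-! ### Lax–Milgram with a holomorphic parameter -/

section LaxMilgram

variable {H G : Type*} [NormedAddCommGroup H] [InnerProductSpace ℂ H]
  [NormedAddCommGroup G] [InnerProductSpace ℂ G] [CompleteSpace G]

/-- The operator on a complete subspace `K` that represents the form `⟪T v, B (T w)⟫` there. -/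
noncomputable def compressOp (T : H →L[ℂ] G) (K : Submodule ℂ H) [CompleteSpace K]
    (B : G →L[ℂ] G) : K →L[ℂ] K :=
  (ContinuousLinearMap.adjoint (T.comp K.subtypeL)).comp (B.comp (T.comp K.subtypeL))

theorem inner_compressOp (T : H →L[ℂ] G) (K : Submodule ℂ H) [CompleteSpace K] (B : G →L[ℂ] G)
    (v w : K) : inner ℂ v (compressOp T K B w) = inner ℂ (T v) (B (T w)) :=
  ContinuousLinearMap.adjoint_inner_right (T.comp K.subtypeL) v _

theorem differentiable_compressOp (T : H →L[ℂ] G) (K : Submodule ℂ H) [CompleteSpace K]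
    {Y : Type*} [NormedAddCommGroup Y]
    [NormedSpace ℂ Y] {B : Y → G →L[ℂ] G} (hB : Differentiable ℂ B) :
    Differentiable ℂ fun y => compressOp T K (B y) :=
  (differentiable_const _).clm_comp (hB.clm_comp (differentiable_const _))

theorem isUnit_of_coercive {K : Type*} [NormedAddCommGroup K] [InnerProductSpace ℂ K]
    [CompleteSpace K] (A : K →L[ℂ] K) {α : ℝ} (hα : 0 < α)
    (h : ∀ v, α * ‖v‖ ^ 2 ≤ (inner ℂ v (A v)).re) : IsUnit A := by
  refine ContinuousLinearMap.isUnit_of_forall_le_norm_inner_map A (c := ⟨α, hα.le⟩) hα fun v => ?_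
  rw [norm_inner_symm]
  calc ‖v‖ ^ 2 * α = α * ‖v‖ ^ 2 := mul_comm _ _
    _ ≤ _ := (h v).trans (Complex.re_le_norm _)

theorem differentiableAt_inverse_apply {K Y : Type*} [NormedAddCommGroup K]
    [InnerProductSpace ℂ K] [CompleteSpace K] [NormedAddCommGroup Y] [NormedSpace ℂ Y]
    {A : Y → K →L[ℂ] K} {y : Y} (hA : DifferentiableAt ℂ A y) (hy : IsUnit (A y)) (r : K) :
    DifferentiableAt ℂ (fun y => Ring.inverse (A y) r) y :=
  (DifferentiableAt.inverse (R := K →L[ℂ] K) hA hy).clm_apply (differentiableAt_const r)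

/-- A vector of `span S` is determined by its inner products with `S`. -/
theorem eq_iff_forall_inner_eq_of_mem_span {S : Set H} {x z : H}
    (hx : x ∈ Submodule.span ℂ S) (hz : z ∈ Submodule.span ℂ S) :
    x = z ↔ ∀ s ∈ S, inner ℂ s x = inner ℂ s z := by
  refine ⟨fun h s _ => by rw [h], fun h => ?_⟩
  have hall : ∀ k ∈ Submodule.span ℂ S, inner ℂ k (x - z) = 0 := fun k hk => by
    induction hk using Submodule.span_induction with
    | mem s hs => rw [inner_sub_right, h s hs, sub_self]
    | zero => exact inner_zero_left _
    | add k l _ _ hk hl => rw [inner_add_left, hk, hl, add_zero]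
    | smul c k _ hk => rw [inner_smul_left, hk, mul_zero]
  exact sub_eq_zero.1 (inner_self_eq_zero.1 (hall _ (Submodule.sub_mem _ hx hz)))

/-- Lax–Milgram for the forms `⟪T v, B y (T w)⟫` on the complete space `span S`, tested with
elements of `S` only. The solution is `A y ⁻¹ r`, and inversion is holomorphic on the units. -/
theorem exists_differentiableOn_solution {Y : Type*} [NormedAddCommGroup Y] [NormedSpace ℂ Y]
    (T : H →L[ℂ] G) {S : Set H} (hS : IsComplete (Submodule.span ℂ S : Set H)) {r : H}
    (hr : r ∈ Submodule.span ℂ S) {B : Y → G →L[ℂ] G} (hB : Differentiable ℂ B) {P : Set Y}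
    {c C : ℝ} (hc : 0 < c) (hC : 0 < C)
    (hcoer : ∀ y ∈ P, ∀ g, c * ‖g‖ ^ 2 ≤ (inner ℂ g (B y g)).re)
    (hT : ∀ w ∈ Submodule.span ℂ S, ‖w‖ ^ 2 ≤ C ^ 2 * ‖T w‖ ^ 2) :
    ∃ u : Y → H,
      (∀ y ∈ P, ∀ w, (w ∈ Submodule.span ℂ S ∧ ∀ s ∈ S,
        inner ℂ (T s) (B y (T w)) = inner ℂ s r) ↔ w = u y) ∧
      DifferentiableOn ℂ u P ∧ ∀ y ∈ P, c * ‖T (u y)‖ ^ 2 ≤ (inner ℂ (u y) r).re := by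
  have : CompleteSpace (Submodule.span ℂ S) := hS.completeSpace_coe
  set A := fun y => compressOp T (Submodule.span ℂ S) (B y) with hA
  have hinner : ∀ y (v w : Submodule.span ℂ S), inner ℂ (v : H) (A y w : H) =
      inner ℂ (T v) (B y (T w)) := fun y v w => inner_compressOp T _ (B y) v w
  have hunit : ∀ y ∈ P, IsUnit (A y) := fun y hy => by
    refine isUnit_of_coercive _ (α := c / C ^ 2) (by positivity) fun w => ?_
    rw [Submodule.coe_inner, hinner]
    refine le_trans ?_ (hcoer y hy (T w))
    rw [div_mul_eq_mul_div, mul_div_assoc]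
    refine mul_le_mul_of_nonneg_left ?_ hc.le
    rw [div_le_iff₀ (by positivity), mul_comm]
    exact hT w w.2
  set r' : Submodule.span ℂ S := ⟨r, hr⟩ with hr'
  have hsolve : ∀ y ∈ P, ∀ w, A y w = r' ↔ w = Ring.inverse (A y) r' := by
    intro y hy w
    constructor
    · intro h
      rw [← h]
      exact (DFunLike.congr_fun (Ring.inverse_mul_cancel _ (hunit y hy)) w).symm
    · rintro rfl
      exact DFunLike.congr_fun (Ring.mul_inverse_cancel _ (hunit y hy)) r'
  have heq : ∀ y (w : Submodule.span ℂ S), A y w = r' ↔ ∀ s ∈ S,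
      inner ℂ (T s) (B y (T w)) = inner ℂ s r := fun y w => by
    rw [Subtype.ext_iff, eq_iff_forall_inner_eq_of_mem_span (A y w).2 hr]
    refine forall₂_congr fun s hs => ?_
    rw [← hinner y ⟨s, Submodule.subset_span hs⟩ w]
  refine ⟨fun y => (Ring.inverse (A y) r' : Submodule.span ℂ S), fun y hy w => ?_, fun y hy => ?_,
    fun y hy => ?_⟩
  · constructor
    · rintro ⟨hw, h⟩
      exact congrArg Subtype.val ((hsolve y hy ⟨w, hw⟩).1 ((heq y ⟨w, hw⟩).2 h))
    · rintro rfl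
      exact ⟨Subtype.property _, (heq y _).1 ((hsolve y hy _).2 rfl)⟩
  · have h1 : DifferentiableAt ℂ A y := differentiable_compressOp T _ hB y
    have h3 := differentiableAt_inverse_apply h1 (hunit y hy) r'
    exact ((Submodule.span ℂ S).subtypeL.differentiableAt.comp y h3).differentiableWithinAt
  · refine (hcoer y hy _).trans_eq ?_
    rw [← hinner, (hsolve y hy _).2 rfl]

/-- Riesz representation of a functional on a complete subspace. -/
theorem exists_mem_forall_inner_eq {X : Type*} [NormedAddCommGroup X] [InnerProductSpace ℝ X]
    {W : Submodule ℝ X} (hW : IsComplete (W : Set X)) (f : X →L[ℝ] ℝ) :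
    ∃ g ∈ W, ∀ v ∈ W, inner ℝ v g = f v := by
  have : CompleteSpace W := hW.completeSpace_coe
  refine ⟨_, ((InnerProductSpace.toDual ℝ W).symm (f.comp W.subtypeL)).2, fun v hv => ?_⟩
  rw [real_inner_comm]
  exact InnerProductSpace.toDual_symm_apply (𝕜 := ℝ) (E := W) (x := ⟨v, hv⟩)
    (y := f.comp W.subtypeL)

theorem inner_add_I_smul_left (x y z : H) :
    inner ℂ (x + Complex.I • y) z = inner ℂ x z - Complex.I * inner ℂ y z := by
  rw [inner_add_left, inner_smul_left, Complex.conj_I, neg_mul, sub_eq_add_neg]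

theorem inner_map_add_I_smul_right (B : H →L[ℂ] H) (x y z : H) :
    inner ℂ z (B (x + Complex.I • y)) = inner ℂ z (B x) + Complex.I * inner ℂ z (B y) := by
  rw [map_add, map_smul, inner_add_right, inner_smul_right]

end LaxMilgram

/-! ### The variational problem on a closed subspace -/

section ClosedSubspace

variable {d M : ℕ} {D : Set (EuclideanSpace ℝ (Fin d))}

theorem diffForm_mkComplexH10 {b : Lp ℂ ⊤ (volume.restrict D)}
    {b' : EuclideanSpace ℝ (Fin d) → ℂ} (hb : b =ᵐ[volume.restrict D] b') (p q v : H10 ℝ D) :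
    diffForm b' (mkComplexH10 p q) v =
      diffForm b' (toComplexH10 p) v + Complex.I * diffForm b' (toComplexH10 q) v := by
  have h : weakGrad (mkComplexH10 p q) =
      weakGrad (toComplexH10 p) + Complex.I • weakGrad (toComplexH10 q) := rfl
  rw [diffForm_eq_inner hb, diffForm_eq_inner hb, diffForm_eq_inner hb, h]
  exact inner_map_add_I_smul_right (mulFieldL D b) _ _ _

/-- The a priori bound from the energy estimate `c ‖∇w‖² ≤ Re ⟪w, g⟫`, where `g` represents `f` on
`W`: only the real part of `w` is paired with `f`. -/
theorem vNorm_le_of_energy_le {W : Submodule ℝ (H10 ℝ D)}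
    {C : ℝ} (hC0 : 0 < C) (hC : ∀ v : H10 ℝ D, ‖v‖ ≤ C * vNorm v) {f : H10 ℝ D →L[ℝ] ℝ}
    {g : H10 ℝ D} (hg : ∀ v ∈ W, inner ℝ v g = f v) {c : ℝ} (hc : 0 < c) {w : H10 ℂ D}
    (hw : w ∈ complexify W) (h1 : c * vNorm w ^ 2 ≤ (inner ℂ w (toComplexH10 g)).re) :
    vNorm w ≤ 1 / c * dualNorm f := by
  have hdual : 0 ≤ dualNorm f := Real.iSup_nonneg fun _ => abs_nonneg _
  have hw0 : 0 ≤ vNorm w := norm_nonneg _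
  obtain ⟨p, hp, q, hq, rfl⟩ := mem_complexify_iff.1 hw
  have h2 : inner ℂ (mkComplexH10 p q) (toComplexH10 g) = (f p : ℂ) - Complex.I * (f q : ℂ) := by
    rw [← hg p hp, ← hg q hq, ← inner_toComplexH10, ← inner_toComplexH10]
    exact inner_add_I_smul_left _ _ _
  have h2' : (inner ℂ (mkComplexH10 p q) (toComplexH10 g)).re = f p := by
    rw [h2]
    simp
  have h3 : vNorm p ≤ vNorm (mkComplexH10 p q) := by
    refine (pow_le_pow_iff_left₀ (norm_nonneg _) hw0 two_ne_zero).1 ?_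
    rw [vNorm_mkComplexH10_sq]
    exact le_add_of_nonneg_right (sq_nonneg _)
  have h4 : c * vNorm (mkComplexH10 p q) ^ 2 ≤ dualNorm f * vNorm (mkComplexH10 p q) :=
    calc _ ≤ f p := h1.trans_eq h2'
      _ ≤ dualNorm f * vNorm p := (le_abs_self _).trans (le_dualNorm_mul_vNorm hC0 hC f p)
      _ ≤ _ := mul_le_mul_of_nonneg_left h3 hdual
  rw [div_mul_eq_mul_div, one_mul, le_div_iff₀ hc]
  rcases hw0.eq_or_lt with h0 | h0
  · rw [← h0, zero_mul]
    exact hdual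
  · refine le_of_mul_le_mul_right ?_ h0
    linarith

/-- For a real parameter, the solution in `W + iW` is real and solves the real problem: its real
part solves the real problem, hence also the complex one, so uniqueness makes it the solution. -/
theorem exists_real_solution {W : Submodule ℝ (H10 ℝ D)}
    {a₀ : EuclideanSpace ℝ (Fin d) → ℝ} {a : Fin M → EuclideanSpace ℝ (Fin d) → ℝ}
    {f : H10 ℝ D →L[ℝ] ℝ} {y : Fin M → ℝ} {b : Lp ℂ ⊤ (volume.restrict D)}
    (hb : b =ᵐ[volume.restrict D] diffCoeff a₀ a fun m => (y m : ℂ)) {u : H10 ℂ D}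
    (hu : ∀ w : H10 ℂ D, (w ∈ complexify W ∧
      SolvesVariational (diffCoeff a₀ a fun m => (y m : ℂ)) f W w) ↔ w = u) :
    ∃ w : H10 ℝ D, (∀ w' : H10 ℝ D,
      (w' ∈ W ∧ SolvesVariational (diffCoeff a₀ a y) f W w') ↔ w' = w) ∧ u = toComplexH10 w := by
  have hlift : ∀ p ∈ W, SolvesVariational (diffCoeff a₀ a y) f W p → toComplexH10 p = u := by
    intro p hp hs
    refine (hu _).1 ⟨toComplexH10_mem_complexify hp, fun v hv => ?_⟩
    rw [diffForm_toComplexH10, hs v hv]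
    rfl
  obtain ⟨hmem, hsol⟩ := (hu u).2 rfl
  obtain ⟨p, hp, q, hq, hpq⟩ := mem_complexify_iff.1 hmem
  have hps : SolvesVariational (diffCoeff a₀ a y) f W p := by
    intro v hv
    have h2 := hsol v hv
    rw [hpq, diffForm_mkComplexH10 hb, diffForm_toComplexH10, diffForm_toComplexH10] at h2
    simpa using congrArg Complex.re h2
  have hup := hlift p hp hps
  refine ⟨p, fun w' => ⟨fun h => ?_, ?_⟩, hup.symm⟩
  · have h0 : toComplexH10 (w' - p) = 0 := by
      rw [toComplexH10_sub, hlift w' h.1 h.2, hup, sub_self]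
    rw [← sub_eq_zero, ← norm_eq_zero, ← norm_toComplexH10, h0, norm_zero]
  · rintro rfl
    exact ⟨hp, hps⟩

/-- Solvability, reality, holomorphy and the a priori bound for the variational problem on a closed
subspace `W` of `H¹₀(D; ℝ)`; the continuous problem is `W = ⊤`, and the Galerkin problems are those
with finite-dimensional `W`. -/
theorem exists_holomorphic_solution (hd : 0 < d) (hD_open : IsOpen D)
    (hD_bdd : Bornology.IsBounded D)
    {a₀ : EuclideanSpace ℝ (Fin d) → ℝ} {a : Fin M → EuclideanSpace ℝ (Fin d) → ℝ}
    (ha₀ : AEStronglyMeasurable a₀ (volume.restrict D))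
    (ha : ∀ m, AEStronglyMeasurable (a m) (volume.restrict D))
    {ρ : Fin M → ℝ} (hρ : ∀ m, 1 < ρ m) (hUEA : WeightedUEA D a₀ a ρ)
    (f : H10 ℝ D →L[ℝ] ℝ) {W : Submodule ℝ (H10 ℝ D)} (hW : IsClosed (W : Set (H10 ℝ D))) :
    ∃ u : (Fin M → ℂ) → H10 ℂ D,
      (∀ y ∈ polydisc ρ, ∀ w : H10 ℂ D,
        (w ∈ complexify W ∧ SolvesVariational (diffCoeff a₀ a y) f W w) ↔ w = u y) ∧
      (∀ y : Fin M → ℝ, (∀ m, y m ∈ Icc (-1 : ℝ) 1) →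
        ∃ w : H10 ℝ D, (∀ w' : H10 ℝ D,
          (w' ∈ W ∧ SolvesVariational (diffCoeff a₀ a y) f W w') ↔ w' = w) ∧
          u (fun m => (y m : ℂ)) = toComplexH10 w) ∧
      DifferentiableOn ℂ u (polydisc ρ) ∧
      ∀ y ∈ polydisc ρ, vNorm (u y) ≤ 1 / lowerConst D a₀ a ρ * dualNorm f := by
  obtain ⟨C, hC0, hC⟩ := exists_norm_le_mul_vNorm hd hD_bdd
  obtain ⟨b, hbd, hb⟩ := hUEA.exists_coeff hD_open.measurableSet hρ ha₀ ha
  have hbre : ∀ y ∈ polydisc ρ, ∀ᵐ x ∂volume.restrict D, lowerConst D a₀ a ρ ≤ (b y x).re := by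
    intro y hy
    filter_upwards [hb y, ae_restrict_mem hD_open.measurableSet] with x hx hxD
    rw [hx]
    exact hUEA.le_re_diffCoeff hy hxD
  obtain ⟨g, hgW, hg⟩ := exists_mem_forall_inner_eq hW.isComplete f
  have hgrad : ∀ w ∈ complexify W, ‖w‖ ^ 2 ≤ C ^ 2 * ‖weakGradL ℂ D w‖ ^ 2 := fun w hw => by
    obtain ⟨p, -, q, -, rfl⟩ := mem_complexify_iff.1 hw
    exact norm_mkComplexH10_le hC p q
  obtain ⟨u, hu, hdiff, hbound⟩ := exists_differentiableOn_solution (weakGradL ℂ D)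
    (S := toComplexH10 '' W) (isComplete_complexify hW) (toComplexH10_mem_complexify hgW)
    (B := fun y => mulFieldL D (b y)) ((mulFieldL D).differentiable.comp hbd) (P := polydisc ρ)
    hUEA.lower_pos hC0 (fun y hy => le_re_inner_mulFieldL (hbre y hy)) hgrad
  have hiff : ∀ y ∈ polydisc ρ, ∀ w : H10 ℂ D,
      (w ∈ complexify W ∧ SolvesVariational (diffCoeff a₀ a y) f W w) ↔ w = u y := by
    intro y hy w
    refine Iff.trans (and_congr_right fun _ => ?_) (hu y hy w)
    rw [forall_mem_image]
    refine forall₂_congr fun v hv => ?_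
    have h1 : diffForm (diffCoeff a₀ a y) w v =
        inner ℂ (weakGrad (toComplexH10 v)) (mulFieldL D (b y) (weakGrad w)) :=
      diffForm_eq_inner (hb y) w v
    have h2 : inner ℂ (toComplexH10 v) (toComplexH10 g) = (f v : ℂ) := by
      rw [inner_toComplexH10, hg v hv]
    exact ⟨fun h => h1.symm.trans (h.trans h2.symm), fun h => h1.trans (h.trans h2)⟩
  refine ⟨u, hiff, fun y hy => ?_, hdiff, fun y hy => ?_⟩
  · refine exists_real_solution (hb _) (hiff (fun m => (y m : ℂ)) fun m => ?_)
    rw [Complex.norm_real, Real.norm_eq_abs]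
    exact (abs_le.2 (hy m)).trans_lt (hρ m)
  · exact vNorm_le_of_energy_le hC0 hC hg hUEA.lower_pos ((hiff y hy _).2 rfl).1 (hbound y hy)

end ClosedSubspace

theorem mainTheorem8 {d M : ℕ} (hd : 0 < d)
    (D : Set (EuclideanSpace ℝ (Fin d))) (hD_open : IsOpen D) (hD_bdd : Bornology.IsBounded D)
    (a₀ : EuclideanSpace ℝ (Fin d) → ℝ) (a : Fin M → EuclideanSpace ℝ (Fin d) → ℝ)
    (ha₀ : AEStronglyMeasurable a₀ (volume.restrict D))
    (ha : ∀ m, AEStronglyMeasurable (a m) (volume.restrict D))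
    (ρ : Fin M → ℝ) (hρ : ∀ m, 1 < ρ m) (hUEA : WeightedUEA D a₀ a ρ)
    (f : H10 ℝ D →L[ℝ] ℝ)
    (V : ℕ → Submodule ℝ (H10 ℝ D)) (hV : ∀ l, FiniteDimensional ℝ (V l)) :
    -- the continuous problem
    (∃ u : (Fin M → ℂ) → H10 ℂ D,
      (∀ y ∈ polydisc ρ, ∀ w : H10 ℂ D,
        SolvesVariational (diffCoeff a₀ a y) f ⊤ w ↔ w = u y) ∧
      (∀ y : Fin M → ℝ, (∀ m, y m ∈ Icc (-1 : ℝ) 1) →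
        ∃ w : H10 ℝ D, (∀ w' : H10 ℝ D,
          SolvesVariational (diffCoeff a₀ a y) f ⊤ w' ↔ w' = w) ∧
          u (fun m => (y m : ℂ)) = toComplexH10 w) ∧
      DifferentiableOn ℂ u (polydisc ρ) ∧
      ∀ y ∈ polydisc ρ, vNorm (u y) ≤ 1 / lowerConst D a₀ a ρ * dualNorm f) ∧
    -- the Galerkin projections
    (∀ l : ℕ, ∃ u : (Fin M → ℂ) → H10 ℂ D,
      (∀ y ∈ polydisc ρ, ∀ w : H10 ℂ D,
        (w ∈ complexify (V l) ∧ SolvesVariational (diffCoeff a₀ a y) f (V l) w) ↔ w = u y) ∧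
      (∀ y : Fin M → ℝ, (∀ m, y m ∈ Icc (-1 : ℝ) 1) →
        ∃ w : H10 ℝ D, (∀ w' : H10 ℝ D,
          (w' ∈ V l ∧ SolvesVariational (diffCoeff a₀ a y) f (V l) w') ↔ w' = w) ∧
          u (fun m => (y m : ℂ)) = toComplexH10 w) ∧
      DifferentiableOn ℂ u (polydisc ρ) ∧
      ∀ y ∈ polydisc ρ, vNorm (u y) ≤ 1 / lowerConst D a₀ a ρ * dualNorm f) := by
  refine ⟨?_, fun l => ?_⟩
  · have h := exists_holomorphic_solution hd hD_open hD_bdd ha₀ ha hρ hUEA f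
      (W := ⊤) isClosed_univ
    simpa only [complexify_top, Submodule.mem_top, true_and] using h
  · have := hV l
    exact exists_holomorphic_solution hd hD_open hD_bdd ha₀ ha hρ hUEA f
      (V l).closed_of_finiteDimensional
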